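/- Let $q\ge 1$, let $C\subset\mathbb R^q$ be compact and convex, and let $f:C\to\mathbb R$ be convex and twice differentiable on $C$, with gradient $\nabla f:C\to\mathbb R^q$. (Differentiability is relative to $C$; if $C$ has empty interior, $\nabla f$ denotes any fixed gradient field of $f$ relative to $C$ that is itself differentiable on $C$.) Assume that - $f$ is $\beta$-smooth on $C$ for some $\beta>0$: $\|\nabla f(x)-\nabla f(y)\|_2\le\beta\|x-y\|_2$ for all $x,y\in C$; - $f$ has a unique minimizer $\theta_\star$ on $C$, $\theta_\star$ lies in the relative interior of $C$, and $f$ is of class $C^2$ in a neighbourhood of $\theta_\star$ (relative to $C$); - the reduced Hessian of $f$ at $\theta_\star$ is positive definite: if $V$ is the direction of the affine hull of $C$, the second derivative at $0$ of the function $v\mapsto f(\theta_\star+v)$, defined for $v\in V$ near $0$, is positive definite on $V$. Let $R'>\max_{x\in C}\|x\|_2$, let $D=\{x\in\mathbb R^q:\|x\|_2<R'\}$, let $$\Phi(x)=\frac{\|x\|_2^2}{R'^2-\|x\|_2^2}\qquad(x\in D),$$ let $D_\Phi(x,y)=\Phi(x)-\Phi(y)-\nabla\Phi(y)^\top(x-y)$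 be its Bregman divergence, and let $0<\eta<2/(R'^2\beta)$. Then $\Phi$ is a mirror map on $D$: it is strictly convex and differentiable on $D$, $\nabla\Phi(D)=\mathbb R^q$, and $\|\nabla\Phi(x)\|\to+\infty$ as $x$ tends to a boundary point of $D$. For every $\theta_0\in C$ the mirror prox algorithm, in which $\zeta'_{n+1},\theta'_{n+1}\in D$ and $$\nabla\Phi(\zeta'_{n+1})=\nabla\Phi(\theta_n)-\eta\nabla f(\theta_n),\qquad \zeta_{n+1}\in\operatorname*{argmin}_{\theta\in C\cap D}D_\Phi(\theta,\zeta'_{n+1}),$$ $$\nabla\Phi(\theta'_{n+1})=\nabla\Phi(\theta_n)-\eta\nabla f(\zeta_{n+1}),\qquad \theta_{n+1}\in\operatorname*{argmin}_{\theta\in C\cap D}D_\Phi(\theta,\theta'_{n+1}),$$ defines exactly one sequence $(\theta_n)_{n\ge0}$ started at $\theta_0$, and this sequence converges to $\theta_\star$, the unique element of $\operatorname{argmin}_C f$. -/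

import Mathlib

open Set Filter Topology

noncomputable section

namespace MirrorProx

/-- The set of minimizers of `f` on `C`. -/
def argminOn {α : Type*} (C : Set α) (f : α → ℝ) : Set α :=
  {x | x ∈ C ∧ ∀ y ∈ C, f x ≤ f y}

/-- `g` is a gradient of `f` on `C`, in the sense of differentiability relative to `C`. This makes
sense for `f` known only on `C`, even if `C` has empty interior (then the component of `g`
normal to the affine hull of `C` is free). If `f` is differentiable in the ambient space at the
points of `C`, then `g = ∇ f` qualifies. -/
def IsGradientOn {E : Type*} [NormedAddCommGroup E] [InnerProductSpace ℝ E] [CompleteSpace E]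
    (C : Set E) (f : E → ℝ) (g : E → E) : Prop :=
  ∀ x ∈ C, HasGradientWithinAt f (g x) C x

/-- The function `f` in the coordinates of the affine hull of `C` centred at `p ∈ C`: the function
`v ↦ f (p + v)` on the direction of the affine hull of `C`. -/
def reduced {E : Type*} [NormedAddCommGroup E] [InnerProductSpace ℝ E]
    (C : Set E) (f : E → ℝ) (p : E) : vectorSpan ℝ C → ℝ :=
  fun v => f (p + v)

/-- The second derivative at `p` of `f` in the coordinates of the affine hull of `C` is positive
definite. -/
def ReducedHessianPosDef {E : Type*} [NormedAddCommGroup E] [InnerProductSpace ℝ E]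
    (C : Set E) (f : E → ℝ) (p : E) : Prop :=
  ∀ v : vectorSpan ℝ C, v ≠ 0 → 0 < fderiv ℝ (fderiv ℝ (reduced C f p)) 0 v v

/-- `Φ` is a mirror map on the nonempty open convex set `D`. -/
structure IsMirrorMap {E : Type*} [NormedAddCommGroup E] [InnerProductSpace ℝ E] [CompleteSpace E]
    (D : Set E) (Φ : E → ℝ) : Prop where
  isOpen : IsOpen D
  nonempty : D.Nonempty
  strictConvexOn : StrictConvexOn ℝ D Φ
  differentiable : ∀ x ∈ D, DifferentiableAt ℝ Φ x
  gradient_surjOn : gradient Φ '' D = univ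
  gradient_diverges : ∀ z ∈ frontier D, Tendsto (fun x => ‖gradient Φ x‖) (𝓝[D] z) atTop

/-- The Bregman divergence `D_Φ(x, y) = Φ x - Φ y - ⟨∇Φ y, x - y⟩`. -/
def bregman {E : Type*} [NormedAddCommGroup E] [InnerProductSpace ℝ E] [CompleteSpace E]
    (Φ : E → ℝ) (x y : E) : ℝ :=
  Φ x - Φ y - inner ℝ (gradient Φ y) (x - y)

/-- One iteration of mirror prox on `C ∩ D`, with mirror map `Φ` on `D`, gradient field `g` of
the objective and step size `η`, from the current point `x` to the next point `y`. The auxiliary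
points are the dual step `z'` from `x` along `g x`, its projection `z`, and the dual step `y'`
from `x` along `g z`, whose projection is `y`. -/
structure IsStep {E : Type*} [NormedAddCommGroup E] [InnerProductSpace ℝ E] [CompleteSpace E]
    (C D : Set E) (Φ : E → ℝ) (g : E → E) (η : ℝ) (x z' z y' y : E) : Prop where
  extrapolate_mem : z' ∈ D
  extrapolate : gradient Φ z' = gradient Φ x - η • g x
  extrapolate_proj : z ∈ argminOn (C ∩ D) (fun t => bregman Φ t z')
  update_mem : y' ∈ D
  update : gradient Φ y' = gradient Φ x - η • g z
  update_proj : y ∈ argminOn (C ∩ D) (fun t => bregman Φ t y')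

/-- `θ` is a sequence produced by mirror prox. -/
def IsMirrorProxSeq {E : Type*} [NormedAddCommGroup E] [InnerProductSpace ℝ E] [CompleteSpace E]
    (C D : Set E) (Φ : E → ℝ) (g : E → E) (η : ℝ) (θ : ℕ → E) : Prop :=
  θ 0 ∈ C ∩ D ∧ ∀ n, ∃ z' z y', IsStep C D Φ g η (θ n) z' z y' (θ (n + 1))

/-- The explicit mirror map `x ↦ ‖x‖² / (r² - ‖x‖²)`, to be used on the open ball of radius `r`
centred at the origin. -/
def ballPotential {E : Type*} [NormedAddCommGroup E] (r : ℝ) (x : E) : ℝ :=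
  ‖x‖ ^ 2 / (r ^ 2 - ‖x‖ ^ 2)

end MirrorProx

end

/-! Mirror prox makes the divergence to the minimizer `a` a Lyapunov function. On the ball, `bregman
(ballPotential R) x y ≥ ‖x - y‖² / R²` (`sq_norm_sub_div_le_bregman`), read off from a closed form
of the divergence. With the three-point identity, the variational inequalities of the two
projections and the Lipschitz bound on `g`, this gives `IsStep.bregman_add_le`: one step from `θ n`
through `z n` lowers the divergence by at least `η ⟪g (z n), z n - a⟫ + κ ‖z n - θ n‖²`, where `κ =
1 / R² - η β / 2` is positive by the step size condition. By convexity the first term dominates `η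
(f (z n) - f a) ≥ 0`. The decreases telescope, so `f (z n) → f a` and `z n - θ n → 0`; compactness
and uniqueness of the minimizer give `z n → a`, hence `θ n → a`. Well-posedness rests on bijectivity
of the gradient from the ball to the whole space and on unique Bregman projections onto the compact
convex set `C`. -/

open scoped RealInnerProductSpace

namespace MirrorProx

variable {E : Type*} [NormedAddCommGroup E] [InnerProductSpace ℝ E]

/-! ### First-order facts about convex functions -/

section FirstOrder

variable [CompleteSpace E]

/-- A convex function lies above its linear approximation at a point of differentiability. -/
lemma add_inner_le_of_convexOn {C : Set E} {f : E → ℝ} {x y a : E} (hf : ConvexOn ℝ C f)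
    (hx : x ∈ C) (hy : y ∈ C) (ha : HasGradientWithinAt f a C x) :
    f x + ⟪a, y - x⟫ ≤ f y := by
  -- Only a derivative relative to `C` is available, so the argument is one-dimensional, along the
  -- segment from `x` to `y` inside `C`.
  have hmaps : MapsTo (AffineMap.lineMap x y : ℝ →ᵃ[ℝ] E) (Icc 0 1) C := by
    intro t ht
    exact hf.1.segment_subset hx hy (lineMap_mem_segment ℝ x y ht)
  have hconv : ConvexOn ℝ (Icc (0 : ℝ) 1) (f ∘ (AffineMap.lineMap x y : ℝ →ᵃ[ℝ] E)) :=
    (hf.comp_affineMap _).subset hmaps (convex_Icc 0 1)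
  have hline : HasDerivWithinAt (AffineMap.lineMap x y : ℝ →ᵃ[ℝ] E) (y - x) (Icc 0 1) 0 :=
    AffineMap.hasDerivWithinAt_lineMap
  have ha' : HasFDerivWithinAt f (InnerProductSpace.toDual ℝ E a) C
      ((AffineMap.lineMap x y : ℝ →ᵃ[ℝ] E) 0) := by
    rw [AffineMap.lineMap_apply_zero]
    exact ha.hasFDerivWithinAt
  have hderiv := ha'.comp_hasDerivWithinAt (0 : ℝ) hline hmaps
  have hslope := hconv.le_slope_of_hasDerivWithinAt (x := 0) (y := 1) (by simp) (by simp)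
    one_pos hderiv
  simp only [InnerProductSpace.toDual_apply_apply, slope_def_field, Function.comp_apply,
    AffineMap.lineMap_apply_zero, AffineMap.lineMap_apply_one, sub_zero, div_one] at hslope
  linarith

lemma IsGradientOn.continuousOn {C : Set E} {f : E → ℝ} {g : E → E} (hg : IsGradientOn C f g) :
    ContinuousOn f C :=
  fun x hx => (hg x hx).hasFDerivWithinAt.continuousWithinAt

/-- The variational inequality satisfied by a minimizer over a convex set. -/
lemma inner_gradient_nonneg_of_mem_argminOn {C : Set E} (hC : Convex ℝ C) {h : E → ℝ} {a x y : E}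
    (hx : x ∈ argminOn C h) (ha : HasGradientAt h a x) (hy : y ∈ C) :
    0 ≤ ⟪a, y - x⟫ := by
  have hloc : IsLocalMinOn h C x :=
    IsMinOn.localize (isMinOn_iff.2 hx.2)
  have := hloc.hasFDerivWithinAt_nonneg ha.hasFDerivAt.hasFDerivWithinAt
    (sub_mem_posTangentConeAt_of_segment_subset (hC.segment_subset hx.1 hy))
  simpa using this

end FirstOrder

/-! ### The potential of the ball -/

section Potential

variable {R : ℝ} {x y z : E}

lemma sq_norm_lt_of_mem_ball {F : Type*} [SeminormedAddCommGroup F] {R : ℝ} {x : F}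
    (hx : x ∈ Metric.ball (0 : F) R) : ‖x‖ ^ 2 < R ^ 2 :=
  pow_lt_pow_left₀ (mem_ball_zero_iff.1 hx) (norm_nonneg x) two_ne_zero

variable [CompleteSpace E]

lemma hasGradientAt_ballPotential (hx : x ∈ Metric.ball (0 : E) R) :
    HasGradientAt (ballPotential R) ((2 * R ^ 2 / (R ^ 2 - ‖x‖ ^ 2) ^ 2) • x) x := by
  have hne : R ^ 2 - ‖x‖ ^ 2 ≠ 0 := (sub_pos.2 (sq_norm_lt_of_mem_ball hx)).ne'
  have hsq : HasFDerivAt (fun t : E => ‖t‖ ^ 2) (2 • innerSL ℝ x) x :=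
    (hasStrictFDerivAt_norm_sq x).hasFDerivAt
  have hreal : HasDerivAt (fun u : ℝ => u / (R ^ 2 - u)) (R ^ 2 / (R ^ 2 - ‖x‖ ^ 2) ^ 2)
      (‖x‖ ^ 2) := by
    refine ((hasDerivAt_id _).fun_div ((hasDerivAt_id _).const_sub (R ^ 2)) hne).congr_deriv ?_
    simp
  rw [hasGradientAt_iff_hasFDerivAt]
  refine (hreal.comp_hasFDerivAt x hsq).congr_fderiv ?_
  ext v
  simp
  ring

lemma gradient_ballPotential (hx : x ∈ Metric.ball (0 : E) R) :
    gradient (ballPotential R) x = (2 * R ^ 2 / (R ^ 2 - ‖x‖ ^ 2) ^ 2) • x :=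
  (hasGradientAt_ballPotential hx).gradient

/-- Exact identity with two nonnegative summands: dropping the first leaves a quadratic lower bound.
-/
lemma bregman_ballPotential (hx : x ∈ Metric.ball (0 : E) R) (hy : y ∈ Metric.ball (0 : E) R) :
    bregman (ballPotential R) x y = R ^ 2 / (R ^ 2 - ‖y‖ ^ 2) ^ 2 *
      ((‖x‖ ^ 2 - ‖y‖ ^ 2) ^ 2 / (R ^ 2 - ‖x‖ ^ 2) + ‖x - y‖ ^ 2) := by
  have hx' : R ^ 2 - ‖x‖ ^ 2 ≠ 0 := (sub_pos.2 (sq_norm_lt_of_mem_ball hx)).ne'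
  have hy' : R ^ 2 - ‖y‖ ^ 2 ≠ 0 := (sub_pos.2 (sq_norm_lt_of_mem_ball hy)).ne'
  rw [bregman, gradient_ballPotential hy, inner_smul_left, inner_sub_right,
    real_inner_self_eq_norm_sq, norm_sub_sq_real, real_inner_comm]
  simp only [ballPotential, conj_trivial]
  field_simp
  ring

lemma sq_norm_sub_div_le_bregman (hx : x ∈ Metric.ball (0 : E) R)
    (hy : y ∈ Metric.ball (0 : E) R) :
    ‖x - y‖ ^ 2 / R ^ 2 ≤ bregman (ballPotential R) x y := by
  have hx' := sub_pos.2 (sq_norm_lt_of_mem_ball hx)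
  have hy' := sub_pos.2 (sq_norm_lt_of_mem_ball hy)
  have hR : 0 < R ^ 2 := by nlinarith [sq_nonneg ‖x‖]
  rw [bregman_ballPotential hx hy]
  -- Holds because `0 < R² - ‖y‖² ≤ R²`.
  have hcoef : 1 / R ^ 2 ≤ R ^ 2 / (R ^ 2 - ‖y‖ ^ 2) ^ 2 := by
    rw [div_le_div_iff₀ hR (by positivity)]
    nlinarith [sq_nonneg ‖y‖]
  calc ‖x - y‖ ^ 2 / R ^ 2 = 1 / R ^ 2 * ‖x - y‖ ^ 2 := by ring
    _ ≤ R ^ 2 / (R ^ 2 - ‖y‖ ^ 2) ^ 2 * ‖x - y‖ ^ 2 := by gcongr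
    _ ≤ _ := by
      gcongr
      exact le_add_of_nonneg_left (by positivity)

lemma bregman_ballPotential_pos (hx : x ∈ Metric.ball (0 : E) R)
    (hy : y ∈ Metric.ball (0 : E) R) (hxy : x ≠ y) : 0 < bregman (ballPotential R) x y := by
  refine lt_of_lt_of_le ?_ (sq_norm_sub_div_le_bregman hx hy)
  have h1 : 0 < ‖x - y‖ := norm_pos_iff.2 (sub_ne_zero.2 hxy)
  have h2 : 0 < R := (norm_nonneg x).trans_lt (mem_ball_zero_iff.1 hx)
  positivity

lemma inner_gradient_sub_gradient (Φ : E → ℝ) (x y : E) :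
    ⟪gradient Φ x - gradient Φ y, x - y⟫ = bregman Φ x y + bregman Φ y x := by
  simp only [bregman, inner_sub_left, inner_sub_right]
  ring

/-- The three-point identity of Bregman divergences. -/
lemma inner_gradient_sub_gradient_three_point (Φ : E → ℝ) (u x y : E) :
    ⟪gradient Φ y - gradient Φ x, u - y⟫ = bregman Φ u x - bregman Φ u y - bregman Φ y x := by
  simp only [bregman, inner_sub_left, inner_sub_right]
  ring

lemma gradient_ballPotential_injOn :
    InjOn (gradient (ballPotential R)) (Metric.ball (0 : E) R) := by
  intro x hx y hy hxy
  by_contra hne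
  have h := inner_gradient_sub_gradient (ballPotential R) x y
  rw [hxy, sub_self, inner_zero_left] at h
  linarith [bregman_ballPotential_pos hx hy hne, bregman_ballPotential_pos hy hx (Ne.symm hne)]

/-- Average the positive divergences of `x` and `y` from `m` with weights `a`, `b`: the gradient
terms cancel because `a (x - m) + b (y - m) = 0`. -/
lemma strictConvexOn_ballPotential :
    StrictConvexOn ℝ (Metric.ball (0 : E) R) (ballPotential R) := by
  refine ⟨convex_ball 0 R, fun x hx y hy hxy a b ha hb hab => ?_⟩
  set m := a • x + b • y with hm
  have hmem : m ∈ Metric.ball (0 : E) R := convex_ball 0 R hx hy ha.le hb.le hab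
  have hb' : b = 1 - a := by linarith
  have hxm : x - m = b • (x - y) := by rw [hm, hb']; module
  have hym : y - m = (-a) • (x - y) := by rw [hm, hb']; module
  have hx_ne : x ≠ m := by
    rw [← sub_ne_zero, hxm]
    exact smul_ne_zero hb.ne' (sub_ne_zero.2 hxy)
  have hy_ne : y ≠ m := by
    rw [← sub_ne_zero, hym]
    exact smul_ne_zero (neg_ne_zero.2 ha.ne') (sub_ne_zero.2 hxy)
  have h1 := mul_pos ha (bregman_ballPotential_pos hx hmem hx_ne)
  have h2 := mul_pos hb (bregman_ballPotential_pos hy hmem hy_ne)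
  rw [bregman, hxm, inner_smul_right] at h1
  rw [bregman, hym, inner_smul_right] at h2
  simp only [smul_eq_mul]
  have h3 : (a + b) * ballPotential R m = ballPotential R m := by rw [hab, one_mul]
  nlinarith

/-- The gradient is radial, so a preimage of `w ≠ 0` is sought on the ray through `w`; its norm `t`
solves a scalar equation, by the intermediate value theorem. -/
lemma gradient_ballPotential_surjOn (hR : 0 < R) (w : E) :
    ∃ x ∈ Metric.ball (0 : E) R, gradient (ballPotential R) x = w := by
  rcases eq_or_ne w 0 with rfl | hw
  · have h0 : (0 : E) ∈ Metric.ball (0 : E) R := Metric.mem_ball_self hR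
    exact ⟨0, h0, by rw [gradient_ballPotential h0, smul_zero]⟩
  have hw' : 0 < ‖w‖ := norm_pos_iff.2 hw
  obtain ⟨t, ht, hroot⟩ : (0 : ℝ) ∈
      (fun t : ℝ => 2 * R ^ 2 * t - ‖w‖ * (R ^ 2 - t ^ 2) ^ 2) '' Icc 0 R := by
    refine intermediate_value_Icc hR.le (by fun_prop) ⟨?_, ?_⟩
    · simp only [mul_zero, zero_sub, Left.neg_nonpos_iff]
      positivity
    · simp only [sub_self, ne_eq, OfNat.ofNat_ne_zero, not_false_eq_true, zero_pow, mul_zero,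
        sub_zero]
      positivity
  -- At `t = R` the polynomial equals `2 R³ ≠ 0`, so the root is interior.
  have htR : t < R := by
    refine lt_of_le_of_ne ht.2 ?_
    rintro rfl
    simp at hroot
    exact hR.ne' hroot
  have hnorm : ‖(t / ‖w‖) • w‖ = t := by
    rw [norm_smul, norm_div, norm_norm, Real.norm_of_nonneg ht.1, div_mul_cancel₀ _ hw'.ne']
  have hmem : (t / ‖w‖) • w ∈ Metric.ball (0 : E) R := by rwa [mem_ball_zero_iff, hnorm]
  refine ⟨_, hmem, ?_⟩
  have hpos : 0 < R ^ 2 - t ^ 2 := by nlinarith [ht.1]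
  rw [gradient_ballPotential hmem, hnorm, smul_smul]
  have : 2 * R ^ 2 / (R ^ 2 - t ^ 2) ^ 2 * (t / ‖w‖) = 1 := by
    field_simp
    simp only at hroot
    linarith
  rw [this, one_smul]

lemma tendsto_norm_gradient_ballPotential (hR : 0 < R) (hz : ‖z‖ = R) :
    Tendsto (fun x => ‖gradient (ballPotential R) x‖) (𝓝[Metric.ball (0 : E) R] z) atTop := by
  have hnum : Tendsto (fun x : E => 2 * R ^ 2 * ‖x‖) (𝓝[Metric.ball (0 : E) R] z)
      (𝓝 (2 * R ^ 2 * ‖z‖)) :=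
    (by fun_prop : Continuous fun x : E => 2 * R ^ 2 * ‖x‖).continuousWithinAt
  have hden : Tendsto (fun x : E => (R ^ 2 - ‖x‖ ^ 2) ^ 2) (𝓝[Metric.ball (0 : E) R] z)
      (𝓝[>] 0) := by
    refine tendsto_nhdsWithin_iff.2 ⟨?_, ?_⟩
    · have h := (by fun_prop : Continuous fun x : E => (R ^ 2 - ‖x‖ ^ 2) ^ 2).continuousWithinAt
        (s := Metric.ball (0 : E) R) (x := z)
      simpa [ContinuousWithinAt, hz] using h
    · filter_upwards [self_mem_nhdsWithin] with x hx
      have := sub_pos.2 (sq_norm_lt_of_mem_ball hx)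
      simp only [mem_Ioi]
      positivity
  have hpos : 0 < 2 * R ^ 2 * ‖z‖ := by rw [hz]; positivity
  refine (hnum.pos_mul_atTop hpos hden.inv_tendsto_nhdsGT_zero).congr' ?_
  filter_upwards [self_mem_nhdsWithin] with x hx
  rw [gradient_ballPotential hx, norm_smul, Real.norm_of_nonneg (by positivity), Pi.inv_apply]
  ring

lemma isMirrorMap_ballPotential (hR : 0 < R) :
    IsMirrorMap (Metric.ball (0 : E) R) (ballPotential R) where
  isOpen := Metric.isOpen_ball
  nonempty := Metric.nonempty_ball.2 hR
  strictConvexOn := strictConvexOn_ballPotential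
  differentiable _ hx := (hasGradientAt_ballPotential hx).differentiableAt
  gradient_surjOn := eq_univ_of_forall fun w => gradient_ballPotential_surjOn hR w
  gradient_diverges z hz := by
    rw [frontier_ball _ hR.ne'] at hz
    exact tendsto_norm_gradient_ballPotential hR (mem_sphere_zero_iff_norm.1 hz)

end Potential

/-! ### Bregman projections -/

section Projection

variable [CompleteSpace E] {R : ℝ} {C : Set E} {w x y : E}

lemma hasGradientAt_bregman_ballPotential (hx : x ∈ Metric.ball (0 : E) R) :
    HasGradientAt (fun t => bregman (ballPotential R) t w)
      (gradient (ballPotential R) x - gradient (ballPotential R) w) x := by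
  have h1 := (hasGradientAt_ballPotential hx).differentiableAt.hasGradientAt.hasFDerivAt
  have h2 : HasFDerivAt (fun t : E => ⟪gradient (ballPotential R) w, t - w⟫)
      (innerSL ℝ (gradient (ballPotential R) w)) x :=
    (innerSL ℝ (gradient (ballPotential R) w)).hasFDerivAt.comp x ((hasFDerivAt_id x).sub_const w)
  rw [hasGradientAt_iff_hasFDerivAt]
  refine ((h1.sub_const (ballPotential R w)).fun_sub h2).congr_fderiv ?_
  ext v
  simp

/-- The variational inequality characterizing Bregman projections. -/
lemma inner_nonneg_of_bregman_proj (hC : Convex ℝ C) (hCR : C ⊆ Metric.ball 0 R)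
    (hx : x ∈ argminOn C (fun t => bregman (ballPotential R) t w)) (hy : y ∈ C) :
    0 ≤ ⟪gradient (ballPotential R) x - gradient (ballPotential R) w, y - x⟫ :=
  inner_gradient_nonneg_of_mem_argminOn hC hx (hasGradientAt_bregman_ballPotential (hCR hx.1)) hy

/-- Testing each variational inequality at the other projection and adding shows that the
symmetrized divergence is at most zero. -/
lemma bregman_proj_unique (hC : Convex ℝ C) (hCR : C ⊆ Metric.ball 0 R)
    (hx : x ∈ argminOn C (fun t => bregman (ballPotential R) t w))
    (hy : y ∈ argminOn C (fun t => bregman (ballPotential R) t w)) : x = y := by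
  by_contra hne
  have h1 := inner_nonneg_of_bregman_proj hC hCR hx hy.1
  have h2 := inner_nonneg_of_bregman_proj hC hCR hy hx.1
  have h3 := inner_gradient_sub_gradient (ballPotential R) x y
  have h4 := bregman_ballPotential_pos (hCR hx.1) (hCR hy.1) hne
  have h5 := bregman_ballPotential_pos (hCR hy.1) (hCR hx.1) (Ne.symm hne)
  simp only [inner_sub_left, inner_sub_right] at h1 h2 h3
  linarith

lemma exists_bregman_proj (hC : IsCompact C) (hne : C.Nonempty) (hCR : C ⊆ Metric.ball 0 R)
    (w : E) : ∃ x, x ∈ argminOn C (fun t => bregman (ballPotential R) t w) := by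
  obtain ⟨x, hx, hmin⟩ := hC.exists_isMinOn hne
    (f := fun t => bregman (ballPotential R) t w) fun t ht =>
      (hasGradientAt_bregman_ballPotential (hCR ht)).hasFDerivAt.continuousAt.continuousWithinAt
  exact ⟨x, hx, isMinOn_iff.1 hmin⟩

end Projection

/-! ### Well-posedness of the iteration -/

section Iteration

variable [CompleteSpace E] {R η : ℝ} {C : Set E} {g : E → E}

/-- The point `x` is arbitrary, so that choice yields a total map to iterate. -/
lemma exists_isStep (hR : 0 < R) (hC : IsCompact C) (hne : C.Nonempty)
    (hCR : C ⊆ Metric.ball 0 R) (x : E) :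
    ∃ y, ∃ z' z y', IsStep C (Metric.ball 0 R) (ballPotential R) g η x z' z y' y := by
  have hinter : C ∩ Metric.ball 0 R = C := inter_eq_left.2 hCR
  obtain ⟨z', hz', hgz'⟩ :=
    gradient_ballPotential_surjOn hR (gradient (ballPotential R) x - η • g x)
  obtain ⟨z, hz⟩ := exists_bregman_proj hC hne hCR z'
  obtain ⟨y', hy', hgy'⟩ :=
    gradient_ballPotential_surjOn hR (gradient (ballPotential R) x - η • g z)
  obtain ⟨y, hy⟩ := exists_bregman_proj hC hne hCR y'
  exact ⟨y, z', z, y', hz', hgz', hinter.symm ▸ hz, hy', hgy', hinter.symm ▸ hy⟩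

lemma IsStep.unique (hC : Convex ℝ C) (hCR : C ⊆ Metric.ball 0 R)
    {x z₁' z₁ y₁' y₁ z₂' z₂ y₂' y₂ : E}
    (h₁ : IsStep C (Metric.ball 0 R) (ballPotential R) g η x z₁' z₁ y₁' y₁)
    (h₂ : IsStep C (Metric.ball 0 R) (ballPotential R) g η x z₂' z₂ y₂' y₂) : y₁ = y₂ := by
  have hinter : C ∩ Metric.ball 0 R = C := inter_eq_left.2 hCR
  have hz' : z₁' = z₂' := gradient_ballPotential_injOn h₁.extrapolate_mem h₂.extrapolate_mem
    (h₁.extrapolate.trans h₂.extrapolate.symm)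
  subst hz'
  have hz : z₁ = z₂ :=
    bregman_proj_unique hC hCR (hinter ▸ h₁.extrapolate_proj) (hinter ▸ h₂.extrapolate_proj)
  subst hz
  have hy' : y₁' = y₂' := gradient_ballPotential_injOn h₁.update_mem h₂.update_mem
    (h₁.update.trans h₂.update.symm)
  subst hy'
  exact bregman_proj_unique hC hCR (hinter ▸ h₁.update_proj) (hinter ▸ h₂.update_proj)

lemma existsUnique_isMirrorProxSeq (hR : 0 < R) (hC : IsCompact C) (hconv : Convex ℝ C)
    (hCR : C ⊆ Metric.ball 0 R) {θ₀ : E} (hθ₀ : θ₀ ∈ C) :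
    ∃! θ : ℕ → E, θ 0 = θ₀ ∧
      IsMirrorProxSeq C (Metric.ball 0 R) (ballPotential R) g η θ := by
  choose next hnext using exists_isStep (g := g) (η := η) hR hC ⟨θ₀, hθ₀⟩ hCR
  refine ⟨fun n => next^[n] θ₀, ⟨rfl, ⟨hθ₀, hCR hθ₀⟩, fun n => ?_⟩, ?_⟩
  · simp only [Function.iterate_succ_apply']
    exact hnext _
  · rintro θ ⟨h0, -, hstep⟩
    funext n
    induction n with
    | zero => exact h0
    | succ n ih =>
      obtain ⟨_, _, _, h₁⟩ := hstep n
      obtain ⟨_, _, _, h₂⟩ := hnext (θ n)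
      rw [Function.iterate_succ_apply', ← ih]
      exact h₁.unique hconv hCR h₂

/-- The one-step estimate of mirror prox for a Lipschitz field `g`. -/
lemma IsStep.bregman_add_le (hC : Convex ℝ C) (hCR : C ⊆ Metric.ball 0 R) {β : ℝ} (hη : 0 ≤ η)
    (hsmooth : ∀ x ∈ C, ∀ y ∈ C, ‖g x - g y‖ ≤ β * ‖x - y‖) (hβ : 0 ≤ β)
    (hβη : η * β / 2 ≤ 1 / R ^ 2) {x z' z y' y u : E} (hx : x ∈ C) (hu : u ∈ C)
    (h : IsStep C (Metric.ball 0 R) (ballPotential R) g η x z' z y' y) :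
    bregman (ballPotential R) u y + η * ⟪g z, z - u⟫ + (1 / R ^ 2 - η * β / 2) * ‖z - x‖ ^ 2 ≤
      bregman (ballPotential R) u x := by
  have hinter : C ∩ Metric.ball 0 R = C := inter_eq_left.2 hCR
  have hzC : z ∈ C := h.extrapolate_proj.1.1
  have hyC : y ∈ C := h.update_proj.1.1
  -- The extrapolation inequality is tested at `y`, not `u`, so that `bregman y x` cancels when the
  -- two three-point identities are added. What remains is the error `η ⟪g z - g x, z - y⟫`.
  have hVIz := inner_nonneg_of_bregman_proj hC hCR (hinter ▸ h.extrapolate_proj) hyC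
  have hVIy := inner_nonneg_of_bregman_proj hC hCR (hinter ▸ h.update_proj) hu
  rw [h.extrapolate] at hVIz
  rw [h.update] at hVIy
  have h3z := inner_gradient_sub_gradient_three_point (ballPotential R) y x z
  have h3y := inner_gradient_sub_gradient_three_point (ballPotential R) u x y
  have hDz := sq_norm_sub_div_le_bregman (hCR hzC) (hCR hx)
  have hDy := sq_norm_sub_div_le_bregman (hCR hyC) (hCR hzC)
  have hlip : ⟪g z - g x, z - y⟫ ≤ β / 2 * (‖z - x‖ ^ 2 + ‖y - z‖ ^ 2) := by
    calc ⟪g z - g x, z - y⟫ ≤ ‖g z - g x‖ * ‖z - y‖ := real_inner_le_norm _ _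
      _ ≤ β * ‖z - x‖ * ‖y - z‖ := by
        rw [norm_sub_rev z y]
        gcongr
        exact hsmooth z hzC x hx
      _ ≤ β / 2 * (‖z - x‖ ^ 2 + ‖y - z‖ ^ 2) := by
        nlinarith [mul_nonneg hβ (sq_nonneg (‖z - x‖ - ‖y - z‖))]
  have hlip' := mul_le_mul_of_nonneg_left hlip hη
  -- The error costs `η β / 2` times each of `‖z - x‖²` and `‖y - z‖²`, paid for by the divergences
  -- `hDz` and `hDy`; the surplus in `‖y - z‖²` is discarded.
  have hslack : 0 ≤ (1 / R ^ 2 - η * β / 2) * ‖y - z‖ ^ 2 :=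
    mul_nonneg (sub_nonneg.2 hβη) (sq_nonneg _)
  rw [div_eq_mul_one_div] at hDz hDy
  simp only [inner_sub_left, inner_sub_right, inner_smul_left, conj_trivial]
    at hVIz hVIy h3z h3y hlip' ⊢
  nlinarith

lemma IsMirrorProxSeq.mem {D : Set E} {Φ : E → ℝ} {θ : ℕ → E}
    (hθ : IsMirrorProxSeq C D Φ g η θ) (n : ℕ) : θ n ∈ C := by
  cases n with
  | zero => exact hθ.1.1
  | succ n =>
    obtain ⟨_, _, _, h⟩ := hθ.2 n
    exact h.update_proj.1.1

end Iteration

/-! ### Convergence -/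

/-- A minimizing sequence of a continuous function on a compact set with a unique minimizer
converges to the minimizer. -/
lemma tendsto_of_tendsto_argminOn {X : Type*} [TopologicalSpace X] {C : Set X} (hC : IsCompact C)
    {f : X → ℝ} (hf : ContinuousOn f C) {a : X} (ha : argminOn C f = {a}) {z : ℕ → X}
    (hz : ∀ n, z n ∈ C) (hfz : Tendsto (fun n => f (z n)) atTop (𝓝 (f a))) :
    Tendsto z atTop (𝓝 a) := by
  refine hC.tendsto_nhds_of_unique_mapClusterPt (.of_forall hz) fun x hx hclus => ?_
  have hmem : a ∈ argminOn C f := ha ▸ mem_singleton a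
  have hle : f x ≤ f a := by
    by_contra! hlt
    obtain ⟨c, hac, hcx⟩ := exists_between hlt
    have hnear : ∀ᶠ t in 𝓝 x, t ∈ C → c < f t :=
      eventually_nhdsWithin_iff.1 ((hf x hx).eventually (lt_mem_nhds hcx))
    have hfreq := hclus.frequently hnear
    obtain ⟨n, h1, h2⟩ := (hfreq.and_eventually (hfz.eventually (gt_mem_nhds hac))).exists
    exact lt_asymm (h1 (hz n)) h2
  have : x ∈ argminOn C f := ⟨hx, fun y hy => hle.trans (hmem.2 y hy)⟩
  rwa [ha, mem_singleton_iff] at this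

/-- A nonnegative sequence which decreases by at least `b n` at each step forces `b` to vanish. -/
lemma tendsto_zero_of_add_le {a b : ℕ → ℝ} (ha : ∀ n, 0 ≤ a n) (hb : ∀ n, 0 ≤ b n)
    (hab : ∀ n, a (n + 1) + b n ≤ a n) : Tendsto b atTop (𝓝 0) := by
  have hanti : Antitone a := antitone_nat_of_succ_le fun n => by linarith [hab n, hb n]
  have hlim := tendsto_atTop_ciInf hanti ⟨0, by rintro _ ⟨n, rfl⟩; exact ha n⟩
  have hdiff := hlim.sub (hlim.comp (tendsto_add_atTop_nat 1))
  rw [sub_self] at hdiff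
  refine squeeze_zero hb (fun n => ?_) hdiff
  have := hab n
  simp only [Function.comp_apply]
  linarith

/-- Mirror prox with the potential of the ball converges to the unique minimizer. -/
lemma IsMirrorProxSeq.tendsto [CompleteSpace E] {C : Set E} (hC : IsCompact C) {f : E → ℝ}
    {g : E → E} {a : E} {β R η : ℝ} (hg : IsGradientOn C f g) (hf : ConvexOn ℝ C f) (hβ : 0 ≤ β)
    (hsmooth : ∀ x ∈ C, ∀ y ∈ C, ‖g x - g y‖ ≤ β * ‖x - y‖) (ha : argminOn C f = {a})
    (hCR : C ⊆ Metric.ball 0 R) (hη : 0 < η) (hβη : η * β / 2 < 1 / R ^ 2) {θ : ℕ → E}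
    (hθ : IsMirrorProxSeq C (Metric.ball 0 R) (ballPotential R) g η θ) :
    Tendsto θ atTop (𝓝 a) := by
  have hmin : a ∈ argminOn C f := ha ▸ mem_singleton a
  choose z' z y' hstep using hθ.2
  have hzC : ∀ n, z n ∈ C := fun n => (hstep n).extrapolate_proj.1.1
  have hκ : 0 < 1 / R ^ 2 - η * β / 2 := sub_pos.2 hβη
  have hgap : ∀ n, 0 ≤ η * (f (z n) - f a) := fun n =>
    mul_nonneg hη.le (sub_nonneg.2 (hmin.2 _ (hzC n)))
  have hsq : ∀ n, 0 ≤ (1 / R ^ 2 - η * β / 2) * ‖z n - θ n‖ ^ 2 := fun n => by positivity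
  have hsum : Tendsto
      (fun n => η * (f (z n) - f a) + (1 / R ^ 2 - η * β / 2) * ‖z n - θ n‖ ^ 2) atTop (𝓝 0) := by
    refine tendsto_zero_of_add_le (a := fun n => bregman (ballPotential R) a (θ n))
      (fun n => ?_) (fun n => add_nonneg (hgap n) (hsq n)) fun n => ?_
    · exact le_trans (by positivity)
        (sq_norm_sub_div_le_bregman (hCR hmin.1) (hCR (hθ.mem n)))
    · have h1 := (hstep n).bregman_add_le hf.1 hCR hη.le hsmooth hβ hβη.le (hθ.mem n) hmin.1
      have h2 := add_inner_le_of_convexOn hf (hzC n) hmin.1 (hg _ (hzC n))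
      have h3 : f (z n) - f a ≤ ⟪g (z n), z n - a⟫ := by
        rw [inner_sub_right] at h2 ⊢
        linarith
      have h4 := mul_le_mul_of_nonneg_left h3 hη.le
      linarith
  have hfz : Tendsto (fun n => f (z n)) atTop (𝓝 (f a)) := by
    have h := squeeze_zero hgap (fun n => le_add_of_nonneg_right (hsq n)) hsum
    have h' := (h.const_mul η⁻¹).add_const (f a)
    rw [mul_zero, zero_add] at h'
    refine h'.congr fun n => ?_
    rw [inv_mul_cancel_left₀ hη.ne', sub_add_cancel]
  have hdist : Tendsto (fun n => ‖z n - θ n‖ ^ 2) atTop (𝓝 0) := by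
    have h := squeeze_zero hsq (fun n => le_add_of_nonneg_left (hgap n)) hsum
    have h' := h.const_mul (1 / R ^ 2 - η * β / 2)⁻¹
    rw [mul_zero] at h'
    exact h'.congr fun n => inv_mul_cancel_left₀ hκ.ne' _
  have hnorm : Tendsto (fun n => z n - θ n) atTop (𝓝 0) := by
    rw [tendsto_zero_iff_norm_tendsto_zero]
    simpa [Real.sqrt_sq] using hdist.sqrt
  have hz := tendsto_of_tendsto_argminOn hC hg.continuousOn ha hzC hfz
  -- `θ n = z n - (z n - θ n)`.
  simpa using hz.sub hnorm

end MirrorProx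

theorem mainTheorem8
    (q : ℕ) (hq : 0 < q)
    (C : Set (EuclideanSpace ℝ (Fin q))) (hC : IsCompact C)
    (f : EuclideanSpace ℝ (Fin q) → ℝ)
    (g : EuclideanSpace ℝ (Fin q) → EuclideanSpace ℝ (Fin q))
    (θs : EuclideanSpace ℝ (Fin q)) (β : ℝ)
    -- `f` is twice differentiable on `C`, with gradient `g`, and `C²` near `θs`
    (hg : MirrorProx.IsGradientOn C f g)
    (hg' : DifferentiableOn ℝ g C)
    (hf2 : ContDiffWithinAt ℝ 2 f C θs)
    -- `f` is convex (in particular `C` is convex) and `β`-smooth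
    (hconv : ConvexOn ℝ C f)
    (hβ : 0 < β)
    (hsmooth : ∀ x ∈ C, ∀ y ∈ C, ‖g x - g y‖ ≤ β * ‖x - y‖)
    -- `θs` is the unique minimizer, it lies in the relative interior, nondegenerately
    (hmin : MirrorProx.argminOn C f = {θs})
    (hri : θs ∈ intrinsicInterior ℝ C)
    (hhess : MirrorProx.ReducedHessianPosDef C f θs)
    -- the radius of the ball and the step size
    (R' : ℝ) (hR' : ∀ x ∈ C, ‖x‖ < R')
    (η : ℝ) (hη : 0 < η) (hη' : η < 2 / (R' ^ 2 * β)) :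
    MirrorProx.IsMirrorMap (Metric.ball (0 : EuclideanSpace ℝ (Fin q)) R')
        (MirrorProx.ballPotential R') ∧
    (∀ θ₀ ∈ C, ∃! θ : ℕ → EuclideanSpace ℝ (Fin q), θ 0 = θ₀ ∧
      MirrorProx.IsMirrorProxSeq C (Metric.ball 0 R') (MirrorProx.ballPotential R') g η θ) ∧
    (∀ θ : ℕ → EuclideanSpace ℝ (Fin q),
      MirrorProx.IsMirrorProxSeq C (Metric.ball 0 R') (MirrorProx.ballPotential R') g η θ →
      Tendsto θ atTop (𝓝 θs)) := by
  have hθs : θs ∈ C := ((hmin ▸ mem_singleton θs : θs ∈ MirrorProx.argminOn C f)).1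
  have hR : 0 < R' := (norm_nonneg θs).trans_lt (hR' θs hθs)
  have hCR : C ⊆ Metric.ball 0 R' := fun x hx => mem_ball_zero_iff.2 (hR' x hx)
  have hβη : η * β / 2 < 1 / R' ^ 2 := by
    rw [lt_div_iff₀ (by positivity)] at hη' ⊢
    linarith
  exact ⟨MirrorProx.isMirrorMap_ballPotential hR,
    fun _ hθ₀ => MirrorProx.existsUnique_isMirrorProxSeq hR hC hconv.1 hCR hθ₀,
    fun _ hθ => hθ.tendsto hC hg hconv hβ.le hsmooth hmin hCR hη hβη⟩
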